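/- Let $Z_+\in\mathbb R$, $\mu\in\mathbb C$, and consider the radial equation $$v''(\xi)+\bigl(k^2\cosh^2\xi+Z_+\cosh\xi-\mu\bigr)v(\xi)=0,\qquad k\in\mathbb C\setminus\{0\},$$ or, for $\tilde v(x):=v(\log(x+1))$, $x=e^{\xi}-1$, the equivalent equation $\bigl((x+1)\tilde v'\bigr)'+q\,\tilde v=0$ with $q(x,k)=\frac{k^2}{4}\bigl(x+1+\frac{2}{x+1}+\frac1{(x+1)^3}\bigr)+\frac{Z_+}{2}\bigl(1+\frac1{(x+1)^2}\bigr)-\frac{\mu}{x+1}$. **Phase function.** For every $j\ge 1$ split $\frac{\mu}{1+\tau^2}-\frac{Z_+}{\sqrt{1+\tau^2}}=s_j(\tau)+l_j(\tau)$ with $s_j\in L^1((0,\infty))$ and $l_j\in C^2((0,\infty))$ real, $|l_j|\le 1/j$, and $l_j(\tau)=-Z_+/\sqrt{1+\tau^2}$ for all large $\tau$. Put $\Omega_j=\{k:|k|^2>1/j\}$ and $\phi_j(\xi,k)=\int_0^{\sinh\xi}\sqrt{k^2-l_j(\tau)}\,d\tau$ for $k\in\Omega_j$, where $\sqrt{k^2-l}:=k\sqrt{1-l/k^2}$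 with the principal root. Let $\phi$ be a global phase function: for every $j\geq 1$ there are an analytic $g_j$ on $\Omega_j$ and an $\widetilde R_j$ with $\phi(\xi,k)=\phi_j(\xi,k)+g_j(k)$ for $\xi>\widetilde R_j$, $k\in\Omega_j$; and $\phi(\xi,-k)=-\phi(\xi,k)$ for all $k\ne0$ and all sufficiently large $\xi$ (depending on $k$). **Solutions.** Let $v_\pm(\xi,k)$ be the solutions with $$v_\pm(\xi,k)=\sqrt2\,e^{-\xi/2}e^{\pm i\phi(\xi,k)}(1+o(1)),\qquad \xi\to\infty,$$ for $k\ne 0$ in the closed upper ($+$), resp. lower ($-$) half-plane, continued analytically in $k$ across the real half-axes: $v_+$ to $-\beta<\arg k<\pi+\alpha$ and $v_-$ to $-\pi-\beta<\arg k<\alpha$, for all $\alpha,\beta\in[0,\pi)$ (domains over $\mathbb C\setminus\{0\}$ that may be two-sheeted; $\arg k\in[0,\pi]$ is the closed upper half-plane for $v_+$, $\arg k\in[-\pi,0]$ the closed lower half-plane for $v_-$). Let $v_0(\xi,k)$ be the solution with $v_0(0,k)=1$, $v_0'(0,k)=0$, and write $\tilde v_{\pm,0}(x,k):=v_{\pm,0}(\log(x+1),k)$.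 With $W(f,g)=(x+1)(fg'-f'g)$ define $$f_\pm(k)=W(\tilde v_\pm,\tilde v_0),\quad e(x,k)=\frac{\tilde v_0(x,k)}{f_+(k)},\quad G(x,x';k)=e(x_<,k)\,\tilde v_+(x_>,k),\quad s(k)=\frac{f_-(k)}{f_+(k)},$$ where $x_<=\min\{x,x'\}$, $x_>=\max\{x,x'\}$. **Claim.** Let $\alpha,\beta\in[0,\pi)$, $k\neq0$, $-\beta<\arg k<\alpha$, with $f_+(k)\ne0$ and $f_+(-k)\neq0$. Here $-k$ is taken with $\arg(-k)=\arg k+\pi$ in $v_+$ and $f_+$ (hence in $e$ and $G$), and with $\arg(-k)=\arg k-\pi$ in $f_-$. Then for all $x,x'>0$: 1. $G(x,x';k)-G(x,x';-k)=2ik\,e(x_<,k)\,e(x_>,-k)$; 2. $s(-k)=s(k)^{-1}$; 3. $s(k)\,e(x,-k)=e(x,k)$. -/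

import Mathlib

noncomputable section

namespace TwoCenter

/-! ### The radial equation -/

/-- `v` solves `v'' + (k² cosh² ξ + Z cosh ξ - μ) v = 0`. The coefficients are entire in `ξ`, so
every solution on the half-line is the restriction of exactly one solution on `ℝ`; solutions are
therefore taken on `ℝ`, which gives meaning to the initial values at `ξ = 0`. -/
structure IsRadialSolution (Z : ℝ) (μ k : ℂ) (v : ℝ → ℂ) : Prop where
  differentiable : Differentiable ℝ v
  equation : ∀ ξ : ℝ, HasDerivAt (deriv v)
    (-(k ^ 2 * (Real.cosh ξ : ℂ) ^ 2 + (Z : ℂ) * (Real.cosh ξ : ℂ) - μ) * v ξ) ξ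

/-! ### The phase function -/

/-- The function `q(τ) = μ / (1 + τ²) - Z / √(1 + τ²)`. -/
def phasePotential (Z : ℝ) (μ : ℂ) (τ : ℝ) : ℂ :=
  μ / ((1 + τ ^ 2 : ℝ) : ℂ) - ((Z / Real.sqrt (1 + τ ^ 2) : ℝ) : ℂ)

/-- `l` is an admissible long-range part of `q` at level `j`: the remainder `q - l` is integrable
on `(0, ∞)`, `l` is `C²` there, `|l| ≤ 1 / j`, and `l` is the Coulomb tail near infinity. -/
structure IsLongRangePart (Z : ℝ) (μ : ℂ) (j : ℕ) (l : ℝ → ℝ) : Prop where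
  shortRange_integrable :
    MeasureTheory.IntegrableOn (fun τ => phasePotential Z μ τ - (l τ : ℂ)) (Set.Ioi 0)
  contDiffOn : ContDiffOn ℝ 2 l (Set.Ioi 0)
  abs_le : ∀ τ : ℝ, 0 < τ → |l τ| ≤ 1 / (j : ℝ)
  tail : ∃ R : ℝ, ∀ τ : ℝ, R < τ → l τ = -(Z / Real.sqrt (1 + τ ^ 2))

/-- The domain `Ω_j = {k : |k|² > 1 / j}`. -/
def phaseDomain (j : ℕ) : Set ℂ := {k : ℂ | 1 / (j : ℝ) < ‖k‖ ^ 2}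

/-- `φ_j(ξ, k) = ∫_0^{sinh ξ} √(k² - l(τ)) dτ`, where on `Ω_j` the root is the branch
`k √(1 - l / k²)`, analytic in `k` and positive for large positive `k`. -/
def localPhase (l : ℝ → ℝ) (ξ : ℝ) (k : ℂ) : ℂ :=
  ∫ τ in (0 : ℝ)..(Real.sinh ξ), k * (1 - (l τ : ℂ) / k ^ 2) ^ (1 / 2 : ℂ)

/-- `φ` is a global phase function: near `ξ = ∞` it differs from each local phase function, on
its domain `Ω_j`, by an analytic function of `k` alone, and it is odd in `k` (as a germ at
`ξ = ∞`). -/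
structure IsGlobalPhase (Z : ℝ) (μ : ℂ) (φ : ℝ → ℂ → ℂ) : Prop where
  local_form : ∃ l : ℕ → ℝ → ℝ, ∀ j : ℕ, 1 ≤ j → IsLongRangePart Z μ j (l j) ∧
    ∃ g : ℂ → ℂ, AnalyticOnNhd ℂ g (phaseDomain j) ∧
      ∃ R : ℝ, ∀ ξ : ℝ, R < ξ → ∀ k ∈ phaseDomain j, φ ξ k = localPhase (l j) ξ k + g k
  odd : ∀ k : ℂ, k ≠ 0 → ∀ᶠ ξ in Filter.atTop, φ ξ (-k) = -φ ξ k

/-! ### Outgoing and incoming solutions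

The spectral parameter lives on a sheeted domain over `ℂ \ {0}`. A point of it is given by its
logarithm `w`, so that `k = exp w` and `arg k = Im w`. The upper half-plane is `0 < Im w < π`, the
lower one (entered through the positive real axis) is `-π < Im w < 0`. -/

/-- The union over `α, β ∈ [0, π)` of the domains `-β < arg k < π + α` of the outgoing
solution. -/
def outgoingDomain : Set ℂ := {w : ℂ | -Real.pi < w.im ∧ w.im < 2 * Real.pi}

/-- The union over `α, β ∈ [0, π)` of the domains `-π - β < arg k < α` of the incoming
solution. -/
def incomingDomain : Set ℂ := {w : ℂ | -(2 * Real.pi) < w.im ∧ w.im < Real.pi}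

/-- `v ξ w` is `v₊(ξ, exp w)`: solutions with
`v₊ = √2 e^{-ξ/2} e^{iφ} (1 + o(1))` for `k` in the closed upper half-plane without `0`, continued
analytically in `k` across the real half-axes. -/
structure IsOutgoingFamily (Z : ℝ) (μ : ℂ) (φ : ℝ → ℂ → ℂ) (v : ℝ → ℂ → ℂ) : Prop where
  solution : ∀ w ∈ outgoingDomain, IsRadialSolution Z μ (Complex.exp w) (fun ξ => v ξ w)
  analytic : ∀ ξ : ℝ, AnalyticOnNhd ℂ (fun w => v ξ w) outgoingDomain
  analytic_deriv : ∀ ξ : ℝ, AnalyticOnNhd ℂ (fun w => deriv (fun t => v t w) ξ) outgoingDomain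
  asymptotics : ∀ w : ℂ, 0 ≤ w.im → w.im ≤ Real.pi →
    Asymptotics.IsEquivalent Filter.atTop (fun ξ => v ξ w)
      (fun ξ => (Real.sqrt 2 : ℂ) * (Real.exp (-ξ / 2) : ℂ) *
        Complex.exp (Complex.I * φ ξ (Complex.exp w)))

/-- `v ξ w` is `v₋(ξ, exp w)`: solutions with
`v₋ = √2 e^{-ξ/2} e^{-iφ} (1 + o(1))` for `k` in the closed lower half-plane without `0`, continued
analytically in `k` across the real half-axes. -/
structure IsIncomingFamily (Z : ℝ) (μ : ℂ) (φ : ℝ → ℂ → ℂ) (v : ℝ → ℂ → ℂ) : Prop where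
  solution : ∀ w ∈ incomingDomain, IsRadialSolution Z μ (Complex.exp w) (fun ξ => v ξ w)
  analytic : ∀ ξ : ℝ, AnalyticOnNhd ℂ (fun w => v ξ w) incomingDomain
  analytic_deriv : ∀ ξ : ℝ, AnalyticOnNhd ℂ (fun w => deriv (fun t => v t w) ξ) incomingDomain
  asymptotics : ∀ w : ℂ, -Real.pi ≤ w.im → w.im ≤ 0 →
    Asymptotics.IsEquivalent Filter.atTop (fun ξ => v ξ w)
      (fun ξ => (Real.sqrt 2 : ℂ) * (Real.exp (-ξ / 2) : ℂ) *
        Complex.exp (-(Complex.I * φ ξ (Complex.exp w))))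

/-- `v₀` solves the radial equation with `v₀(0) = 1`, `v₀'(0) = 0`. -/
structure IsRegularSolution (Z : ℝ) (μ k : ℂ) (v : ℝ → ℂ) : Prop where
  solution : IsRadialSolution Z μ k v
  value_zero : v 0 = 1
  deriv_zero : deriv v 0 = 0

open Classical in
/-- The outgoing solution `v₊`, the (unique) outgoing family for the phase function `φ`. -/
def outgoing (Z : ℝ) (μ : ℂ) (φ : ℝ → ℂ → ℂ) : ℝ → ℂ → ℂ :=
  if h : ∃ v, IsOutgoingFamily Z μ φ v then h.choose else 0

open Classical in
/-- The incoming solution `v₋`, the (unique) incoming family for the phase function `φ`. -/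
def incoming (Z : ℝ) (μ : ℂ) (φ : ℝ → ℂ → ℂ) : ℝ → ℂ → ℂ :=
  if h : ∃ v, IsIncomingFamily Z μ φ v then h.choose else 0

open Classical in
/-- The regular solution `v₀`. -/
def regular (Z : ℝ) (μ k : ℂ) : ℝ → ℂ :=
  if h : ∃ v, IsRegularSolution Z μ k v then h.choose else 0

/-! ### The variable `x = e^ξ - 1` -/

/-- `ṽ₊(x, k) = v₊(log (x + 1), k)`. -/
def outgoingX (Z : ℝ) (μ : ℂ) (φ : ℝ → ℂ → ℂ) (x : ℝ) (w : ℂ) : ℂ :=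
  outgoing Z μ φ (Real.log (x + 1)) w

/-- `ṽ₋(x, k) = v₋(log (x + 1), k)`. -/
def incomingX (Z : ℝ) (μ : ℂ) (φ : ℝ → ℂ → ℂ) (x : ℝ) (w : ℂ) : ℂ :=
  incoming Z μ φ (Real.log (x + 1)) w

/-- `ṽ₀(x, k) = v₀(log (x + 1), k)`. -/
def regularX (Z : ℝ) (μ : ℂ) (x : ℝ) (k : ℂ) : ℂ :=
  regular Z μ k (Real.log (x + 1))

/-- The Wronskian `W_x(f, g) = p(x) (f(x) g'(x) - f'(x) g(x))` with `p(x) = x + 1`. -/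
def wronskian (f g : ℝ → ℂ) (x : ℝ) : ℂ :=
  ((x + 1 : ℝ) : ℂ) * (f x * deriv g x - deriv f x * g x)

/-! ### Jost functions, generalised eigenfunctions, Green's function, scattering element

The Wronskians of two solutions do not depend on `x`; they are evaluated at `x = 0`. -/

/-- The Jost function `f₊ = W(ṽ₊, ṽ₀)` at `k = exp w`. -/
def jostPlus (Z : ℝ) (μ : ℂ) (φ : ℝ → ℂ → ℂ) (w : ℂ) : ℂ :=
  wronskian (fun x => outgoingX Z μ φ x w) (fun x => regularX Z μ x (Complex.exp w)) 0

/-- The Jost function `f₋ = W(ṽ₋, ṽ₀)` at `k = exp w`. -/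
def jostMinus (Z : ℝ) (μ : ℂ) (φ : ℝ → ℂ → ℂ) (w : ℂ) : ℂ :=
  wronskian (fun x => incomingX Z μ φ x w) (fun x => regularX Z μ x (Complex.exp w)) 0

/-- The generalised eigenfunction `e(x, k) = f₊(k)⁻¹ ṽ₀(x, k)` at `k = exp w`. -/
def genEigenfunction (Z : ℝ) (μ : ℂ) (φ : ℝ → ℂ → ℂ) (x : ℝ) (w : ℂ) : ℂ :=
  (jostPlus Z μ φ w)⁻¹ * regularX Z μ x (Complex.exp w)

/-- The radial Green's function `G(x, x'; k) = e(x_<, k) ṽ₊(x_>, k)` at `k = exp w`. -/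
def greenFunction (Z : ℝ) (μ : ℂ) (φ : ℝ → ℂ → ℂ) (x x' : ℝ) (w : ℂ) : ℂ :=
  genEigenfunction Z μ φ (min x x') w * outgoingX Z μ φ (max x x') w

/-- The scattering matrix element `s(k) = f₋(k) / f₊(k)`. Here `p` and `m` are the points over
the same `k` in the domains of `f₊` and of `f₋`, that is `exp p = exp m = k`. -/
def scatteringElement (Z : ℝ) (μ : ℂ) (φ : ℝ → ℂ → ℂ) (p m : ℂ) : ℂ :=
  jostMinus Z μ φ m / jostPlus Z μ φ p

/-! ### The points `k` and `-k`

For `k ≠ 0` off the negative half-axis, `k` lies in both domains, with logarithm `Complex.log k`.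
The point `-k` lies in the domain of the outgoing solution with `arg (-k) = arg k + π` and in the
domain of the incoming solution with `arg (-k) = arg k - π`. -/

/-- The point `k`, with its principal argument. -/
def pt (k : ℂ) : ℂ := Complex.log k

/-- The point `-k` in the domain of the outgoing solution. -/
def negPtOut (k : ℂ) : ℂ := Complex.log k + Real.pi * Complex.I

/-- The point `-k` in the domain of the incoming solution. -/
def negPtIn (k : ℂ) : ℂ := Complex.log k - Real.pi * Complex.I

end TwoCenter

end

/-! The equation contains `k` only through `k ^ 2`, so `regular` is even in `k`, and an outgoing
solution at `-k` solves the equation at `k`. As `φ` is odd, the outgoing family shifted by `π * I`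
in the logarithm is an incoming family (`IsOutgoingFamily.isIncomingFamily`). Incoming families are
unique (`IsIncomingFamily.eq`): on the negative imaginary axis the asymptotics single out the
recessive solution, and the identity theorem does the rest. Hence `f₋(k) = f₊(-k)`, and claims 2 and
3 are algebra.

Claim 1 rests on `W(v₊(-k), v₊(k)) = 2ik` (`IsOutgoingFamily.radialWronskian_add_pi`), found on the
positive half-axis from the asymptotics and continued analytically. Expanding `v₀` in these two
solutions then gives `v₊(k) f₊(-k) - v₊(-k) f₊(k) = 2ik v₀`.

The asymptotics say nothing about derivatives of the solutions, so no Wronskian can be read off at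
infinity directly. Both limiting arguments use instead a quotient of solutions, whose derivative is
the Wronskian divided by a square. -/

namespace TwoCenter

open Filter Topology Asymptotics

/-! ### Linear theory of the radial equation -/

/-- The Wronskian `u v' - u' v` in the variable `ξ`. -/
noncomputable def radialWronskian (u v : ℝ → ℂ) (ξ : ℝ) : ℂ := u ξ * deriv v ξ - deriv u ξ * v ξ

theorem isRadialSolution_neg (Z : ℝ) (μ k : ℂ) :
    IsRadialSolution Z μ (-k) = IsRadialSolution Z μ k := by
  funext v
  refine propext ⟨fun h => ⟨h.1, ?_⟩, fun h => ⟨h.1, ?_⟩⟩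
  · simpa only [neg_sq] using h.2
  · simpa only [neg_sq] using h.2

/-- `regular` is made by choice, so the defining predicates at `k` and `-k` are shown to be equal;
the chosen solutions then agree without appeal to uniqueness. -/
theorem regular_neg (Z : ℝ) (μ k : ℂ) : regular Z μ (-k) = regular Z μ k := by
  have h : IsRegularSolution Z μ (-k) = IsRegularSolution Z μ k := by
    funext v
    refine propext ⟨fun h => ⟨?_, h.2, h.3⟩, fun h => ⟨?_, h.2, h.3⟩⟩
    · rw [← isRadialSolution_neg]; exact h.1
    · rw [isRadialSolution_neg]; exact h.1
  exact congrArg (fun P : (ℝ → ℂ) → Prop =>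
    open Classical in if h : ∃ v, P v then h.choose else (0 : ℝ → ℂ)) h

variable {Z : ℝ} {μ k : ℂ} {u v : ℝ → ℂ}

theorem IsRadialSolution.hasDerivAt (hu : IsRadialSolution Z μ k u) (ξ : ℝ) :
    HasDerivAt u (deriv u ξ) ξ :=
  (hu.differentiable ξ).hasDerivAt

theorem IsRadialSolution.radialWronskian_eq (hu : IsRadialSolution Z μ k u)
    (hv : IsRadialSolution Z μ k v) (ξ η : ℝ) :
    radialWronskian u v ξ = radialWronskian u v η := by
  have h : ∀ t, HasDerivAt (radialWronskian u v) 0 t := fun t => by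
    refine (((hu.hasDerivAt t).mul (hv.equation t)).sub
      ((hu.equation t).mul (hv.hasDerivAt t))).congr_deriv ?_
    ring
  exact is_const_of_deriv_eq_zero (fun t => (h t).differentiableAt) (fun t => (h t).deriv) ξ η

theorem IsRadialSolution.hasDerivAt_div (hu : IsRadialSolution Z μ k u)
    (hv : IsRadialSolution Z μ k v) {ξ : ℝ} (h0 : u ξ ≠ 0) :
    HasDerivAt (fun t => v t / u t) (radialWronskian u v 0 / u ξ ^ 2) ξ := by
  refine ((hv.hasDerivAt ξ).div (hu.hasDerivAt ξ) h0).congr_deriv ?_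
  rw [hu.radialWronskian_eq hv 0 ξ, radialWronskian]
  ring

theorem IsRadialSolution.eq_of_initial (hu : IsRadialSolution Z μ k u)
    (hv : IsRadialSolution Z μ k v) {ξ : ℝ} (h0 : u ξ = v ξ) (h1 : deriv u ξ = deriv v ξ) :
    u = v := by
  funext η
  set q : ℝ → ℂ := fun t => -(k ^ 2 * (Real.cosh t : ℂ) ^ 2 + (Z : ℂ) * (Real.cosh t : ℂ) - μ)
    with hq
  have hqc : Continuous q := by
    have : Continuous fun t : ℝ => (Real.cosh t : ℂ) :=
      Complex.continuous_ofReal.comp Real.continuous_cosh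
    fun_prop
  set a := min ξ η - 1 with ha
  set b := max ξ η + 1 with hb
  have hξ : ξ ∈ Set.Ioo a b := ⟨by linarith [min_le_left ξ η], by linarith [le_max_left ξ η]⟩
  have hη : η ∈ Set.Ioo a b := ⟨by linarith [min_le_right ξ η], by linarith [le_max_right ξ η]⟩
  obtain ⟨M, hM⟩ := (isCompact_Icc (a := a) (b := b)).exists_bound_of_continuousOn hqc.continuousOn
  -- The first-order system for `(u, u')` is Lipschitz with constant `max 1 M` on a bounded interval
  -- around both points.
  have key := ODE_solution_unique_of_mem_Ioo (E := ℂ × ℂ)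
    (v := fun t y => (y.2, q t * y.1)) (s := fun _ => Set.univ) (K := (max 1 M).toNNReal)
    (f := fun t => (u t, deriv u t)) (g := fun t => (v t, deriv v t)) (t₀ := ξ) (a := a) (b := b)
    (fun t ht => ?_) hξ
    (fun t _ => ⟨(hu.hasDerivAt t).prodMk (hu.equation t), trivial⟩)
    (fun t _ => ⟨(hv.hasDerivAt t).prodMk (hv.equation t), trivial⟩)
    (Prod.ext h0 h1)
  · exact congrArg Prod.fst (key hη)
  · refine (LipschitzWith.of_dist_le_mul fun x y => ?_).lipschitzOnWith
    rw [Real.coe_toNNReal _ (le_trans zero_le_one (le_max_left _ _)), dist_eq_norm, dist_eq_norm]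
    have h1 : ‖(x - y).1‖ ≤ ‖x - y‖ := norm_fst_le _
    have h2 : ‖(x - y).2‖ ≤ ‖x - y‖ := norm_snd_le _
    have e : ((x.2, q t * x.1) : ℂ × ℂ) - (y.2, q t * y.1) = ((x - y).2, q t * (x - y).1) := by
      simp [mul_sub]
    rw [e, Prod.norm_mk, norm_mul]
    refine max_le ?_ ?_
    · nlinarith [le_max_left 1 M, norm_nonneg (x - y)]
    · exact mul_le_mul ((hM t ⟨ht.1.le, ht.2.le⟩).trans (le_max_right _ _)) h1 (norm_nonneg _)
        (le_trans zero_le_one (le_max_left _ _))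

/-! ### Functions with vanishing derivative at infinity -/

theorem tendsto_shift_sub_of_deriv_tendsto_zero {f f' : ℝ → ℂ}
    (hf : ∀ᶠ t in atTop, HasDerivAt f (f' t) t) (hf' : Tendsto f' atTop (𝓝 0)) (s : ℝ)
    (hs : 0 < s) : Tendsto (fun t => f (t + s) - f t) atTop (𝓝 0) := by
  rw [Metric.tendsto_nhds]
  intro ε hε
  have h2 : ∀ᶠ t in atTop, ‖f' t‖ < ε / (2 * s) := by
    have := (Metric.tendsto_nhds.1 hf') (ε / (2 * s)) (by positivity)
    simpa using this
  obtain ⟨R, hR⟩ := eventually_atTop.1 (hf.and h2)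
  filter_upwards [eventually_ge_atTop R] with t ht
  have := (convex_Icc t (t + s)).norm_image_sub_le_of_norm_hasDerivWithin_le
    (f := f) (f' := f') (C := ε / (2 * s))
    (fun x hx => (hR x (ht.trans hx.1)).1.hasDerivWithinAt)
    (fun x hx => (hR x (ht.trans hx.1)).2.le) (x := t) (y := t + s)
    ⟨le_rfl, by linarith⟩ ⟨by linarith, le_rfl⟩
  rw [dist_zero_right]
  refine this.trans_lt ?_
  rw [add_sub_cancel_left, Real.norm_of_nonneg hs.le]
  field_simp
  linarith

/-- If `E` oscillates like `exp (2 i k t)` and `h` is asymptotic to `E` with `h' - W E → 0`,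
then `W = 2 i k`. -/
theorem eq_of_oscillating_asymptotics {k m : ℝ} (hk : 0 < k) (hm : 0 < m)
    {E E' h h' : ℝ → ℂ} {W : ℂ}
    (hE : ∀ᶠ t in atTop, HasDerivAt E (E' t) t) (hEm : ∀ᶠ t in atTop, ‖E t‖ = m)
    (hE' : Tendsto (fun t => E' t - 2 * Complex.I * k * E t) atTop (𝓝 0))
    (hh : ∀ᶠ t in atTop, HasDerivAt h (h' t) t)
    (hhE : Tendsto (fun t => h t - E t) atTop (𝓝 0))
    (hh' : Tendsto (fun t => h' t - W * E t) atTop (𝓝 0)) : W = 2 * Complex.I * k := by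
  have hk' : (k : ℂ) ≠ 0 := by exact_mod_cast hk.ne'
  set c : ℂ := W / (2 * Complex.I * k) with hc
  have hcW : c * (2 * Complex.I * k) = W := div_mul_cancel₀ _ (by simp [hk'])
  -- Half a period of `exp (2 i k t)`: this shift nearly reverses the sign of `E`.
  set s : ℝ := Real.pi / (2 * k) with hs
  have hs0 : 0 < s := by positivity
  -- The factor `c` is chosen so that `h' - c E' → 0`; increments of `h - c E` over a fixed shift
  -- therefore vanish at infinity.
  have t1 : Tendsto (fun t => (h (t + s) - c * E (t + s)) - (h t - c * E t)) atTop (𝓝 0) := by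
    refine tendsto_shift_sub_of_deriv_tendsto_zero (f := fun t => h t - c * E t)
      (f' := fun t => h' t - c * E' t) ?_ ?_ s hs0
    · filter_upwards [hE, hh] with t h1 h2 using h2.sub (h1.const_mul c)
    · have := hh'.sub (hE'.const_mul c)
      simp only [mul_zero, sub_zero] at this
      refine this.congr fun t => ?_
      rw [← hcW]; ring
  have shift : Tendsto (fun t : ℝ => t + s) atTop atTop := tendsto_atTop_add_const_right _ _ tendsto_id
  have t2 : Tendsto (fun t => (1 - c) * (E (t + s) - E t)) atTop (𝓝 0) := by
    have := (t1.sub (hhE.comp shift)).add hhE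
    simp only [sub_zero, add_zero] at this
    refine this.congr fun t => ?_
    simp only [Function.comp]; ring
  -- Removing the oscillation by `r` leaves a function whose derivative tends to zero, and `r`
  -- changes sign under the shift.
  have t3 : Tendsto (fun t => E (t + s) + E t) atTop (𝓝 0) := by
    set r : ℝ → ℂ := fun t => Complex.exp (((-(2 * k * t) : ℝ) : ℂ) * Complex.I) with hr
    have hrn : ∀ t, ‖r t‖ = 1 := fun t => Complex.norm_exp_ofReal_mul_I _
    have hrd : ∀ t, HasDerivAt r (r t * (-(2 * k) * Complex.I)) t := fun t => by
      have h1 : HasDerivAt (fun t : ℝ => -(2 * k * t)) (-(2 * k)) t := by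
        simpa using ((hasDerivAt_id t).const_mul (2 * k)).fun_neg
      refine (h1.ofReal_comp.mul_const Complex.I).cexp.congr_deriv ?_
      simp [hr]
    have t4 := tendsto_shift_sub_of_deriv_tendsto_zero (f := fun t => E t * r t)
      (f' := fun t => (E' t - 2 * Complex.I * k * E t) * r t) (by
        filter_upwards [hE] with t ht
        refine (ht.mul (hrd t)).congr_deriv ?_
        ring) (by
        rw [tendsto_zero_iff_norm_tendsto_zero] at hE' ⊢
        simpa [hrn] using hE') s hs0
    rw [tendsto_zero_iff_norm_tendsto_zero] at t4 ⊢
    refine t4.congr fun t => ?_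
    have hrs : r (t + s) = -r t := by
      have : (((-(2 * k * (t + s)) : ℝ) : ℂ) * Complex.I)
          = ((-(2 * k * t) : ℝ) : ℂ) * Complex.I - Real.pi * Complex.I := by
        have : 2 * k * (t + s) = 2 * k * t + Real.pi := by rw [hs]; field_simp
        rw [this]; push_cast; ring
      simp only [hr]
      rw [this, Complex.exp_sub, Complex.exp_pi_mul_I, div_neg, div_one]
    rw [hrs, ← mul_one ‖E (t + s) + E t‖, ← hrn t, ← norm_mul, ← norm_neg]
    congr 1; ring
  have t5 : Tendsto (fun t => (1 - c) * E t) atTop (𝓝 0) := by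
    have := ((t3.const_mul (1 - c)).sub t2).mul_const (1 / 2)
    simp only [mul_zero, sub_zero, zero_mul] at this
    refine this.congr fun t => ?_
    ring
  have t6 : Tendsto (fun t => ‖(1 - c) * E t‖) atTop (𝓝 (‖1 - c‖ * m)) := by
    refine tendsto_const_nhds.congr' ?_
    filter_upwards [hEm] with t ht
    rw [norm_mul, ht]
  have t7 := tendsto_nhds_unique t6 (tendsto_zero_iff_norm_tendsto_zero.1 t5)
  have h8 : 1 - c = 0 := by
    rcases mul_eq_zero.1 t7 with h | h
    · exact norm_eq_zero.1 h
    · exact absurd h hm.ne'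
  rw [← hcW, ← sub_eq_zero.1 h8, one_mul]

/-! ### Identity theorem along horizontal lines -/

theorem frequently_im_eq (z : ℂ) : ∃ᶠ w in 𝓝[≠] z, w.im = z.im := by
  have h : Tendsto (fun t : ℝ => z + t) (𝓝[≠] 0) (𝓝[≠] z) := by
    refine tendsto_nhdsWithin_iff.2 ⟨?_, ?_⟩
    · have : Continuous fun t : ℝ => z + t := by fun_prop
      have := this.tendsto 0
      simp only [Complex.ofReal_zero, add_zero] at this
      exact this.mono_left nhdsWithin_le_nhds
    · filter_upwards [self_mem_nhdsWithin] with t ht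
      simpa using ht
  exact h.frequently (Eventually.of_forall fun t => by simp).frequently

theorem isPreconnected_strip (a b : ℝ) : IsPreconnected {w : ℂ | a < w.im ∧ w.im < b} :=
  ((convex_Ioo a b).is_linear_preimage Complex.imLm.isLinear).isPreconnected

theorem eqOn_strip_of_eq_on_line {f g : ℂ → ℂ} {a b c : ℝ} (ha : a < c) (hb : c < b)
    (hf : AnalyticOnNhd ℂ f {w | a < w.im ∧ w.im < b})
    (hg : AnalyticOnNhd ℂ g {w | a < w.im ∧ w.im < b})
    (h : ∀ w : ℂ, w.im = c → f w = g w) : Set.EqOn f g {w | a < w.im ∧ w.im < b} :=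
  hf.eqOn_of_preconnected_of_frequently_eq hg (isPreconnected_strip a b)
    (z₀ := c * Complex.I) (by simp [ha, hb])
    ((frequently_im_eq _).mono fun w hw => h w (by simpa using hw))

end TwoCenter

namespace TwoCenter

open Filter Topology Asymptotics

/-! ### The phase function on the coordinate axes -/

theorem localPhase_eq_real_integral {l : ℝ → ℝ} {b c : ℝ} {k : ℂ} (hk : k ^ 2 = c)
    (hl : ∀ τ : ℝ, 0 < τ → |l τ| ≤ b) (hc : b < |c|) {ξ : ℝ} (hξ : 0 ≤ ξ) :
    localPhase l ξ k = k * ((∫ τ in (0 : ℝ)..(Real.sinh ξ), √(1 - l τ / c) : ℝ) : ℂ) := by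
  rw [localPhase, ← intervalIntegral.integral_ofReal, ← intervalIntegral.integral_const_mul]
  refine intervalIntegral.integral_congr_ae (Eventually.of_forall fun τ hτ => ?_)
  rw [Set.uIoc_of_le (Real.sinh_nonneg_iff.2 hξ)] at hτ
  have h1 : l τ / c ≤ 1 := by
    refine (le_abs_self _).trans ?_
    rw [abs_div]
    exact div_le_one_of_le₀ ((hl τ hτ.1).trans hc.le) (abs_nonneg _)
  have h2 : (1 : ℂ) - (l τ : ℂ) / k ^ 2 = ((1 - l τ / c : ℝ) : ℂ) := by rw [hk]; push_cast; rfl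
  have h3 : (1 / 2 : ℂ) = ((1 / 2 : ℝ) : ℂ) := by push_cast; rfl
  rw [h2, h3, ← Complex.ofReal_cpow (by linarith), ← Real.sqrt_eq_rpow]

theorem exists_level {r : ℝ} (hr : 0 < r) : ∃ j : ℕ, 1 ≤ j ∧ 1 / (j : ℝ) < r := by
  obtain ⟨n, hn⟩ := exists_nat_one_div_lt hr
  exact ⟨n + 1, by omega, by exact_mod_cast hn⟩

variable {Z : ℝ} {μ : ℂ} {φ : ℝ → ℂ → ℂ}

/-- When `k ^ 2` is real, a level `j` with `1 / j < |k ^ 2|` keeps the radicand positive, so the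
root is real and the phase is `k` times a real integral plus a constant. -/
theorem IsGlobalPhase.exists_real_form (hφ : IsGlobalPhase Z μ φ) {k : ℂ} {c : ℝ}
    (hk : k ^ 2 = c) (hc : c ≠ 0) :
    ∃ (l : ℝ → ℝ) (b : ℝ) (g : ℂ), b < |c| ∧ (∀ τ : ℝ, 0 < τ → |l τ| ≤ b) ∧
      ContinuousOn l (Set.Ioi 0) ∧ Tendsto l atTop (𝓝 0) ∧
      ∀ᶠ ξ in atTop, φ ξ k
        = k * ((∫ τ in (0 : ℝ)..(Real.sinh ξ), √(1 - l τ / c) : ℝ) : ℂ) + g := by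
  obtain ⟨j, hj, hjc⟩ := exists_level (abs_pos.2 hc)
  obtain ⟨l, hl⟩ := hφ.local_form
  obtain ⟨hL, g, -, R, hg⟩ := hl j hj
  refine ⟨l j, 1 / j, g k, hjc, hL.abs_le, hL.contDiffOn.continuousOn, ?_, ?_⟩
  · obtain ⟨T, hT⟩ := hL.tail
    have h1 : Tendsto (fun τ : ℝ => √(1 + τ ^ 2)) atTop atTop := by
      refine tendsto_atTop_mono (fun τ => ?_) tendsto_id
      exact Real.le_sqrt_of_sq_le (by simp)
    have h2 : Tendsto (fun τ : ℝ => -(Z / √(1 + τ ^ 2))) atTop (𝓝 0) := by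
      simpa using (h1.const_div_atTop Z).neg
    refine h2.congr' ?_
    filter_upwards [eventually_gt_atTop T] with τ hτ using (hT τ hτ).symm
  · filter_upwards [eventually_gt_atTop R, eventually_ge_atTop 0] with ξ h1 h2
    rw [hg ξ h1 k ?_, localPhase_eq_real_integral hk hL.abs_le hjc h2]
    show 1 / (j : ℝ) < ‖k‖ ^ 2
    rwa [← norm_pow, hk, Complex.norm_real]

/-- Supplies the non-growing exponential `exp (g - Q)` that makes the incoming solution recessive at
`k = -iκ`. -/
theorem IsGlobalPhase.exists_neg_imag_form (hφ : IsGlobalPhase Z μ φ) {κ : ℝ} (hκ : 0 < κ) :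
    ∃ (g : ℂ) (Q : ℝ → ℝ), ∀ᶠ ξ in atTop, 0 ≤ Q ξ ∧
      -(Complex.I * φ ξ (-(Complex.I * κ))) = g - Q ξ := by
  obtain ⟨l, b, g, -, -, -, -, h⟩ := hφ.exists_real_form (k := -(Complex.I * κ)) (c := -κ ^ 2)
    (by push_cast; rw [neg_sq, mul_pow, Complex.I_sq]; ring) (by simp [hκ.ne'])
  refine ⟨-(Complex.I * g),
    fun ξ => κ * ∫ τ in (0 : ℝ)..(Real.sinh ξ), √(1 - l τ / (-κ ^ 2)), ?_⟩
  filter_upwards [h, eventually_ge_atTop 0] with ξ h1 h2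
  refine ⟨mul_nonneg hκ.le (intervalIntegral.integral_nonneg (Real.sinh_nonneg_iff.2 h2)
    fun _ _ => Real.sqrt_nonneg _), ?_⟩
  rw [h1, Complex.ofReal_mul]
  linear_combination (κ : ℂ) * ((∫ τ in (0 : ℝ)..(Real.sinh ξ), √(1 - l τ / (-κ ^ 2)) : ℝ) : ℂ)
    * Complex.I_sq

theorem IsGlobalPhase.exists_pos_form (hφ : IsGlobalPhase Z μ φ) {k : ℝ} (hk : 0 < k) :
    ∃ (g : ℂ) (P p : ℝ → ℝ), (∀ᶠ t in atTop, HasDerivAt P (p t) t) ∧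
      Tendsto p atTop (𝓝 1) ∧ ∀ᶠ ξ in atTop, φ ξ k = k * P (Real.sinh ξ) + g := by
  obtain ⟨l, b, g, hb, hl, hlc, hl0, h⟩ := hφ.exists_real_form (k := k) (c := k ^ 2)
    (by push_cast; rfl) (by positivity)
  set p : ℝ → ℝ := fun τ => √(1 - l τ / k ^ 2) with hp
  have hpc : ContinuousOn p (Set.Ioi 0) :=
    Real.continuous_sqrt.comp_continuousOn (continuousOn_const.sub (hlc.div_const _))
  refine ⟨g, fun t => ∫ τ in (0 : ℝ)..t, p τ, p, ?_, ?_, h⟩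
  · filter_upwards [eventually_gt_atTop 0] with t ht
    refine intervalIntegral.integral_hasDerivAt_right ?_
      (hpc.stronglyMeasurableAtFilter isOpen_Ioi t ht) (hpc.continuousAt (Ioi_mem_nhds ht))
    rw [intervalIntegrable_iff_integrableOn_Ioc_of_le ht.le]
    refine MeasureTheory.IntegrableOn.of_bound (C := 2) (by simp)
      ((hpc.mono fun τ hτ => hτ.1).aestronglyMeasurable measurableSet_Ioc) ?_
    refine MeasureTheory.ae_restrict_of_forall_mem measurableSet_Ioc fun τ hτ => ?_
    rw [Real.norm_of_nonneg (Real.sqrt_nonneg _)]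
    refine Real.sqrt_le_iff.2 ⟨zero_le_two, ?_⟩
    have h1 : |l τ / k ^ 2| ≤ 1 := by
      rw [abs_div]
      exact div_le_one_of_le₀ ((hl τ hτ.1).trans hb.le) (abs_nonneg _)
    linarith [(abs_le.1 h1).1]
  · have : Tendsto (fun τ => √(1 - l τ / k ^ 2)) atTop (𝓝 (√(1 - 0 / k ^ 2))) :=
      (Real.continuous_sqrt.tendsto _).comp (tendsto_const_nhds.sub (hl0.div_const _))
    simpa using this

/-! ### Recessive solutions -/

/-- The quotient `v / u` tends to 1, while its derivative is `W / u ^ 2`. Since `exp (2 * g) / u ^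
2` has real part bounded below, a nonzero `W` would make a multiple of the quotient drift forever.
So `W = 0`, and the quotient is constantly 1 near infinity. -/
theorem IsRadialSolution.eq_of_recessive {k : ℂ} {u v : ℝ → ℂ}
    (hu : IsRadialSolution Z μ k u) (hv : IsRadialSolution Z μ k v) {g : ℂ} {Q : ℝ → ℝ}
    (hQ : ∀ᶠ ξ in atTop, 0 ≤ Q ξ)
    (hua : IsEquivalent atTop u
      fun ξ => (Real.sqrt 2 : ℂ) * (Real.exp (-ξ / 2) : ℂ) * Complex.exp (g - Q ξ))
    (hva : IsEquivalent atTop v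
      fun ξ => (Real.sqrt 2 : ℂ) * (Real.exp (-ξ / 2) : ℂ) * Complex.exp (g - Q ξ)) :
    u = v := by
  set A : ℝ → ℂ := fun ξ => (Real.sqrt 2 : ℂ) * (Real.exp (-ξ / 2) : ℂ) * Complex.exp (g - Q ξ)
    with hA
  have hA0 : ∀ ξ, A ξ ≠ 0 := fun ξ => by
    simp only [hA, ne_eq, mul_eq_zero, Complex.exp_ne_zero, Complex.ofReal_eq_zero,
      (Real.exp_pos _).ne', or_false]
    positivity
  have hA2 : ∀ ξ, A ξ ^ 2 * (Real.exp (ξ + 2 * Q ξ) : ℂ) = 2 * Complex.exp (2 * g) := fun ξ => by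
    have h2 : ((Real.sqrt 2 : ℝ) : ℂ) ^ 2 = 2 := by
      rw [← Complex.ofReal_pow, Real.sq_sqrt zero_le_two]; norm_num
    simp only [hA, mul_pow, h2, ← Complex.exp_nat_mul, Complex.ofReal_exp]
    rw [mul_assoc, mul_assoc, ← Complex.exp_add, ← Complex.exp_add]
    congr 2
    push_cast; ring
  have hα : Tendsto (fun ξ => u ξ / A ξ) atTop (𝓝 1) :=
    (isEquivalent_iff_tendsto_one (Eventually.of_forall hA0)).1 hua
  have hβ : Tendsto (fun ξ => v ξ / A ξ) atTop (𝓝 1) :=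
    (isEquivalent_iff_tendsto_one (Eventually.of_forall hA0)).1 hva
  have hu0 : ∀ᶠ ξ in atTop, u ξ ≠ 0 := by
    filter_upwards [hα.eventually_ne one_ne_zero] with ξ h h0
    simp [h0] at h
  have hh : Tendsto (fun ξ => v ξ / u ξ) atTop (𝓝 1) := by
    have := hβ.div hα one_ne_zero
    rw [div_one] at this
    exact this.congr fun ξ => div_div_div_cancel_right₀ (hA0 ξ) _ _
  -- The expression is `exp (ξ + 2 * Q ξ) / 2`, at least 1/2, times a factor tending to 1. The
  -- prefactor `exp (-ξ / 2)` makes `0 ≤ Q` sufficient; no growth of `Q` is needed.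
  have hre : ∀ᶠ ξ in atTop, 1 / 4 ≤ (Complex.exp (2 * g) / u ξ ^ 2).re := by
    have h1 : Tendsto (fun ξ => ((u ξ / A ξ) ^ 2)⁻¹.re) atTop (𝓝 1) := by
      have := (hα.pow 2).inv₀ (by simp)
      rw [one_pow, inv_one] at this
      exact (Complex.continuous_re.tendsto 1).comp this
    filter_upwards [h1.eventually_const_le (show (1 / 2 : ℝ) < 1 by norm_num), hu0, hQ,
      eventually_ge_atTop 0] with ξ h2 h3 h4 h5
    have h6 : Complex.exp (2 * g) / u ξ ^ 2
        = ((Real.exp (ξ + 2 * Q ξ) / 2 : ℝ) : ℂ) * ((u ξ / A ξ) ^ 2)⁻¹ := by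
      have := hA2 ξ
      have := hA0 ξ
      push_cast at *
      field_simp
      linear_combination -hA2 ξ
    rw [h6, Complex.re_ofReal_mul]
    have h7 : 1 ≤ Real.exp (ξ + 2 * Q ξ) := Real.one_le_exp (by linarith)
    nlinarith
  have hder : ∀ᶠ ξ in atTop,
      HasDerivAt (fun t => v t / u t) (radialWronskian u v 0 / u ξ ^ 2) ξ := by
    filter_upwards [hu0] with ξ h using hu.hasDerivAt_div hv h
  have hW : radialWronskian u v 0 = 0 := by
    by_contra hW
    set W := radialWronskian u v 0
    set f : ℝ → ℝ := fun ξ => (Complex.exp (2 * g) / W * (v ξ / u ξ)).re with hf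
    have hfd : ∀ᶠ ξ in atTop, HasDerivAt f (Complex.exp (2 * g) / u ξ ^ 2).re ξ := by
      filter_upwards [hder] with ξ h
      have h1 := h.const_mul (Complex.exp (2 * g) / W)
      have h2 := (Complex.reCLM.hasFDerivAt (x := Complex.exp (2 * g) / W * (v ξ / u ξ))).comp_hasDerivAt ξ h1
      refine h2.congr_deriv ?_
      simp only [Complex.reCLM_apply]
      congr 1
      field_simp
    have hfl : Tendsto f atTop (𝓝 (Complex.exp (2 * g) / W * 1).re) :=
      (Complex.continuous_re.tendsto _).comp (hh.const_mul _)
    have hfs : Tendsto (fun ξ => f (ξ + 1) - f ξ) atTop (𝓝 0) := by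
      have := (hfl.comp (tendsto_atTop_add_const_right _ (1 : ℝ) tendsto_id)).sub hfl
      simpa using this
    obtain ⟨R, hR⟩ := eventually_atTop.1 (hfd.and hre)
    have : ∀ᶠ ξ in atTop, 1 / 4 ≤ f (ξ + 1) - f ξ := by
      filter_upwards [eventually_ge_atTop R] with ξ hξ
      obtain ⟨c, hc, hc'⟩ := exists_hasDerivAt_eq_slope f
        (fun ξ => (Complex.exp (2 * g) / u ξ ^ 2).re) (show ξ < ξ + 1 by linarith)
        (fun x hx => (hR x (hξ.trans hx.1)).1.continuousAt.continuousWithinAt)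
        (fun x hx => (hR x (hξ.trans hx.1.le)).1)
      have := (hR c (hξ.trans hc.1.le)).2
      rw [hc'] at this
      simpa using this
    have := ge_of_tendsto hfs this
    norm_num at this
  obtain ⟨R, hR⟩ := eventually_atTop.1 (hder.and hu0)
  have hconst : ∀ ξ ∈ Set.Ioi R, v ξ = u ξ := fun ξ hξ => by
    have h1 : ∀ᶠ η in atTop, v η / u η = v ξ / u ξ := by
      filter_upwards [eventually_gt_atTop R] with η hη
      refine isOpen_Ioi.is_const_of_deriv_eq_zero (f := fun t => v t / u t) isPreconnected_Ioi
        (fun x hx => (hR x (Set.mem_Ioi.1 hx).le).1.differentiableAt.differentiableWithinAt)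
        (fun x hx => ?_) (Set.mem_Ioi.2 hη) hξ
      rw [(hR x (Set.mem_Ioi.1 hx).le).1.deriv, hW]; simp
    have h2 := tendsto_nhds_unique (hh.congr' h1) tendsto_const_nhds
    exact ((div_eq_one_iff_eq (hR ξ (Set.mem_Ioi.1 hξ).le).2).1 h2.symm)
  have hloc : u =ᶠ[𝓝 (R + 1)] v := by
    filter_upwards [Ioi_mem_nhds (show R < R + 1 by linarith)] with ξ hξ using (hconst ξ hξ).symm
  exact hu.eq_of_initial hv hloc.eq_of_nhds hloc.deriv_eq

end TwoCenter

namespace TwoCenter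

open Filter Topology Asymptotics

variable {Z : ℝ} {μ : ℂ} {φ : ℝ → ℂ → ℂ} {v v' : ℝ → ℂ → ℂ}

/-! ### The incoming family in terms of the outgoing family -/

theorem exp_add_pi_mul_I (w : ℂ) : Complex.exp (w + Real.pi * Complex.I) = -Complex.exp w := by
  rw [Complex.exp_add, Complex.exp_pi_mul_I, mul_neg_one]

theorem im_add_pi_mul_I (w : ℂ) : (w + Real.pi * Complex.I).im = w.im + Real.pi := by simp

theorem add_pi_mul_I_mem_outgoingDomain {w : ℂ} (hw : w ∈ incomingDomain) :
    w + Real.pi * Complex.I ∈ outgoingDomain := by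
  obtain ⟨h1, h2⟩ := hw
  constructor <;> rw [im_add_pi_mul_I] <;> linarith

theorem analyticOnNhd_add_pi_mul_I {f : ℂ → ℂ} (hf : AnalyticOnNhd ℂ f outgoingDomain) :
    AnalyticOnNhd ℂ (fun w => f (w + Real.pi * Complex.I)) incomingDomain := fun w hw =>
  (hf _ (add_pi_mul_I_mem_outgoingDomain hw)).fun_comp
    (f := fun w : ℂ => w + Real.pi * Complex.I) (by fun_prop)

theorem IsOutgoingFamily.asymptotics_add_pi (hφ : IsGlobalPhase Z μ φ)
    (hv : IsOutgoingFamily Z μ φ v) {w : ℂ} (h1 : -Real.pi ≤ w.im) (h2 : w.im ≤ 0) :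
    IsEquivalent atTop (fun ξ => v ξ (w + Real.pi * Complex.I))
      (fun ξ => (Real.sqrt 2 : ℂ) * (Real.exp (-ξ / 2) : ℂ) *
        Complex.exp (-(Complex.I * φ ξ (Complex.exp w)))) := by
  have h := hv.asymptotics (w + Real.pi * Complex.I) (by rw [im_add_pi_mul_I]; linarith)
    (by rw [im_add_pi_mul_I]; linarith)
  refine h.congr_right ?_
  filter_upwards [hφ.odd (Complex.exp w) (Complex.exp_ne_zero w)] with ξ hξ
  rw [exp_add_pi_mul_I, hξ, mul_neg]

theorem IsOutgoingFamily.isIncomingFamily (hφ : IsGlobalPhase Z μ φ)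
    (hv : IsOutgoingFamily Z μ φ v) :
    IsIncomingFamily Z μ φ (fun ξ w => v ξ (w + Real.pi * Complex.I)) where
  solution w hw := by
    have := hv.solution _ (add_pi_mul_I_mem_outgoingDomain hw)
    rwa [exp_add_pi_mul_I, isRadialSolution_neg] at this
  analytic ξ := analyticOnNhd_add_pi_mul_I (hv.analytic ξ)
  analytic_deriv ξ := analyticOnNhd_add_pi_mul_I (hv.analytic_deriv ξ)
  asymptotics _ h1 h2 := hv.asymptotics_add_pi hφ h1 h2

/-- Uniqueness by recessiveness is needed only on the line `Im w = -π / 2`, that is for `k` on the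
negative imaginary axis; analyticity spreads it over the strip. -/
theorem IsIncomingFamily.eq (hφ : IsGlobalPhase Z μ φ) (hv : IsIncomingFamily Z μ φ v)
    (hv' : IsIncomingFamily Z μ φ v') {w : ℂ} (hw : w ∈ incomingDomain) (ξ : ℝ) :
    v ξ w = v' ξ w := by
  have hpi := Real.pi_pos
  refine eqOn_strip_of_eq_on_line (c := -(Real.pi / 2)) (by linarith) (by linarith)
    (hv.analytic ξ) (hv'.analytic ξ) (fun w hw => ?_) hw
  have hmem : w ∈ incomingDomain := ⟨by rw [hw]; linarith, by rw [hw]; linarith⟩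
  have hexp : Complex.exp w = -(Complex.I * (Real.exp w.re : ℝ)) := by
    rw [← Complex.re_add_im w, hw]
    have : (w.re + (-(Real.pi / 2) : ℝ) * Complex.I : ℂ)
        = w.re + -(Real.pi / 2 * Complex.I) := by push_cast; ring
    rw [this, Complex.exp_add, Complex.exp_neg, Complex.exp_pi_div_two_mul_I, Complex.inv_I]
    simp only [Complex.add_re, Complex.neg_re, Complex.ofReal_re, Complex.ofReal_exp]
    simp; ring
  obtain ⟨g, Q, hQ⟩ := hφ.exists_neg_imag_form (Real.exp_pos w.re)
  have key : ∀ u : ℝ → ℂ → ℂ, IsIncomingFamily Z μ φ u → IsEquivalent atTop (fun ξ => u ξ w)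
      fun ξ => (Real.sqrt 2 : ℂ) * (Real.exp (-ξ / 2) : ℂ) * Complex.exp (g - Q ξ) := by
    intro u hu
    refine (hu.asymptotics w (by rw [hw]; linarith) (by rw [hw]; linarith)).congr_right ?_
    filter_upwards [hQ] with ξ hξ
    rw [hexp, hξ.2]
  exact congrFun ((hv.solution w hmem).eq_of_recessive (hv'.solution w hmem)
    (hQ.mono fun _ h => h.1) (key v hv) (key v' hv')) ξ

/-! ### The Wronskian of the outgoing and the incoming solution -/

theorem tendsto_arsinh_atTop : Tendsto Real.arsinh atTop atTop :=
  Real.sinhOrderIso.symm.tendsto_atTop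

/-- With `t = sinh ξ` this quotient is `exp ξ / (2 cosh ξ)`, the factor left over in the derivative
of `b / a` with respect to `t`. -/
theorem tendsto_add_sqrt_div :
    Tendsto (fun t : ℝ => (t + √(1 + t ^ 2)) / (2 * √(1 + t ^ 2))) atTop (𝓝 1) := by
  have h1 : Tendsto (fun t : ℝ => (√((t ^ 2)⁻¹ + 1))⁻¹) atTop (𝓝 1) := by
    have h2 : Tendsto (fun t : ℝ => (t ^ 2)⁻¹ + 1) atTop (𝓝 (0 + 1)) :=
      (tendsto_inv_atTop_zero.comp (tendsto_pow_atTop two_ne_zero)).add_const 1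
    have := ((Real.continuous_sqrt.tendsto _).comp h2).inv₀ (by simp)
    simpa using this
  have h3 := (h1.add_const 1).div_const 2
  norm_num at h3
  refine h3.congr' ?_
  filter_upwards [eventually_gt_atTop 0] with t ht
  have h4 : √(1 + t ^ 2) = t * √((t ^ 2)⁻¹ + 1) := by
    rw [show 1 + t ^ 2 = t ^ 2 * ((t ^ 2)⁻¹ + 1) by field_simp, Real.sqrt_mul (sq_nonneg t),
      Real.sqrt_sq ht.le]
  have h5 : 0 < √((t ^ 2)⁻¹ + 1) := by positivity
  rw [h4]
  field_simp

theorem tendsto_zero_mul_of_norm_eq {x E : ℝ → ℂ} {m : ℝ} (hx : Tendsto x atTop (𝓝 0))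
    (hE : ∀ t, ‖E t‖ = m) : Tendsto (fun t => x t * E t) atTop (𝓝 0) := by
  rw [tendsto_zero_iff_norm_tendsto_zero] at hx ⊢
  simpa [hE] using hx.mul_const m

theorem IsRadialSolution.radialWronskian_eq_two_mul_I {k : ℝ} (hk : 0 < k)
    (hφ : IsGlobalPhase Z μ φ) {a b : ℝ → ℂ} (ha : IsRadialSolution Z μ k a)
    (hb : IsRadialSolution Z μ k b)
    (haa : IsEquivalent atTop a fun ξ => (Real.sqrt 2 : ℂ) * (Real.exp (-ξ / 2) : ℂ) *
      Complex.exp (-(Complex.I * φ ξ k)))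
    (hba : IsEquivalent atTop b fun ξ => (Real.sqrt 2 : ℂ) * (Real.exp (-ξ / 2) : ℂ) *
      Complex.exp (Complex.I * φ ξ k)) :
    radialWronskian a b 0 = 2 * Complex.I * k := by
  obtain ⟨g, P, p, hP, hp, hφP⟩ := hφ.exists_pos_form hk
  have hs2 : (Real.sqrt 2 : ℂ) ≠ 0 := by
    rw [Ne, Complex.ofReal_eq_zero]; positivity
  have hs2' : ((Real.sqrt 2 : ℝ) : ℂ) ^ 2 = 2 := by
    rw [← Complex.ofReal_pow, Real.sq_sqrt zero_le_two]; norm_num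
  set B : ℝ → ℂ := fun ξ => (Real.sqrt 2 : ℂ) * (Real.exp (-ξ / 2) : ℂ) with hB
  have hB0 : ∀ ξ, B ξ ≠ 0 := fun ξ =>
    mul_ne_zero hs2 (Complex.ofReal_ne_zero.2 (Real.exp_pos _).ne')
  have hB2 : ∀ ξ, B ξ ^ 2 * (Real.exp ξ : ℝ) = 2 := fun ξ => by
    rw [hB]
    simp only [mul_pow, hs2', ← Complex.ofReal_pow, ← Real.exp_nat_mul]
    rw [mul_assoc, ← Complex.ofReal_mul, ← Real.exp_add,
      show ((2 : ℕ) : ℝ) * (-ξ / 2) + ξ = 0 by push_cast; ring]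
    simp
  set α : ℝ → ℂ := fun ξ => a ξ / (B ξ * Complex.exp (-(Complex.I * φ ξ k))) with hα
  set β : ℝ → ℂ := fun ξ => b ξ / (B ξ * Complex.exp (Complex.I * φ ξ k)) with hβ
  have hα1 : Tendsto α atTop (𝓝 1) := (isEquivalent_iff_tendsto_one (Eventually.of_forall
    fun ξ => mul_ne_zero (hB0 ξ) (Complex.exp_ne_zero _))).1 haa
  have hβ1 : Tendsto β atTop (𝓝 1) := (isEquivalent_iff_tendsto_one (Eventually.of_forall
    fun ξ => mul_ne_zero (hB0 ξ) (Complex.exp_ne_zero _))).1 hba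
  have ha0 : ∀ᶠ ξ in atTop, a ξ ≠ 0 := by
    filter_upwards [hα1.eventually_ne one_ne_zero] with ξ h h0
    simp [hα, h0] at h
  -- This is `exp (2 i φ)` in the variable `t = sinh ξ`, where the phase has derivative tending to
  -- `k`. The constant `g` may be complex, so the modulus of `E` is constant but need not be 1.
  set E : ℝ → ℂ := fun t => Complex.exp (2 * Complex.I * (k * P t + g)) with hE
  have hEm : ∀ t, ‖E t‖ = Real.exp (-2 * g.im) := fun t => by
    rw [hE, Complex.norm_exp]
    simp
  have hEφ : ∀ᶠ t in atTop, E t = Complex.exp (Complex.I * φ (Real.arsinh t) k) ^ 2 := by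
    filter_upwards [tendsto_arsinh_atTop.eventually hφP] with t ht
    rw [ht, Real.sinh_arsinh, ← Complex.exp_nat_mul, Nat.cast_ofNat, ← mul_assoc]
  refine eq_of_oscillating_asymptotics (m := Real.exp (-2 * g.im)) hk (Real.exp_pos _)
    (E := E) (E' := fun t => 2 * Complex.I * k * p t * E t)
    (h := fun t => b (Real.arsinh t) / a (Real.arsinh t))
    (h' := fun t => radialWronskian a b 0 / a (Real.arsinh t) ^ 2 * ((√(1 + t ^ 2))⁻¹ : ℝ))
    ?_ (Eventually.of_forall hEm) ?_ ?_ ?_ ?_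
  · filter_upwards [hP] with t ht
    refine (((ht.ofReal_comp.const_mul (k : ℂ)).add_const g).const_mul
      (2 * Complex.I)).cexp.congr_deriv ?_
    rw [hE]; ring
  · have h1 : Tendsto (fun t => 2 * Complex.I * k * ((p t : ℂ) - 1)) atTop (𝓝 0) := by
      have := (((Complex.continuous_ofReal.tendsto 1).comp hp).sub_const 1).const_mul
        (2 * Complex.I * k)
      simpa using this
    refine (tendsto_zero_mul_of_norm_eq h1 hEm).congr fun t => ?_
    ring
  · filter_upwards [tendsto_arsinh_atTop.eventually ha0] with t ht
    refine ((ha.hasDerivAt_div hb ht).scomp t (Real.hasDerivAt_arsinh t)).congr_deriv ?_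
    rw [Complex.real_smul, mul_comm]
  · have h1 : Tendsto (fun t => β (Real.arsinh t) / α (Real.arsinh t) - 1) atTop (𝓝 0) := by
      have := ((hβ1.div hα1 one_ne_zero).sub_const 1).comp tendsto_arsinh_atTop
      rw [div_one, sub_self] at this
      exact this
    refine (tendsto_zero_mul_of_norm_eq h1 hEm).congr' ?_
    filter_upwards [hEφ, tendsto_arsinh_atTop.eventually ha0] with t ht h0
    have hb0 := hB0 (Real.arsinh t)
    rw [ht]
    simp only [hα, hβ, Complex.exp_neg]
    have := Complex.exp_ne_zero (Complex.I * φ (Real.arsinh t) k)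
    field_simp
  -- As `a ^ 2` is asymptotic to `2 exp (-ξ) / E`, the derivative of `b / a` in `t` behaves like `W
  -- E exp ξ / (2 cosh ξ)`.
  · have h1 : Tendsto (fun t : ℝ => radialWronskian a b 0 *
        ((((t + √(1 + t ^ 2)) / (2 * √(1 + t ^ 2)) : ℝ) : ℂ) / α (Real.arsinh t) ^ 2 - 1))
        atTop (𝓝 0) := by
      have := ((((Complex.continuous_ofReal.tendsto 1).comp tendsto_add_sqrt_div).div
        ((hα1.comp tendsto_arsinh_atTop).pow 2) (by simp)).sub_const 1).const_mul
        (radialWronskian a b 0)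
      simpa using this
    refine (tendsto_zero_mul_of_norm_eq h1 hEm).congr' ?_
    filter_upwards [hEφ, tendsto_arsinh_atTop.eventually ha0] with t ht h0
    have hb0 := hB0 (Real.arsinh t)
    have h2 := hB2 (Real.arsinh t)
    rw [Real.exp_arsinh] at h2
    have hs : ((√(1 + t ^ 2) : ℝ) : ℂ) ≠ 0 := by
      rw [Ne, Complex.ofReal_eq_zero]; positivity
    rw [ht]
    simp only [hα, Complex.exp_neg]
    push_cast at h2 ⊢
    have := Complex.exp_ne_zero (Complex.I * φ (Real.arsinh t) k)
    field_simp
    linear_combination (radialWronskian a b 0) * h2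

/-- On `Im w = 0` both asymptotics are available, as the positive half-axis bounds both half-planes.
Both sides are analytic for `|Im w| < π`, the overlap of the two domains. -/
theorem IsOutgoingFamily.radialWronskian_add_pi (hφ : IsGlobalPhase Z μ φ)
    (hv : IsOutgoingFamily Z μ φ v) {w : ℂ} (h1 : -Real.pi < w.im) (h2 : w.im < Real.pi) :
    radialWronskian (fun ξ => v ξ (w + Real.pi * Complex.I)) (fun ξ => v ξ w) 0
      = 2 * Complex.I * Complex.exp w := by
  have hpi := Real.pi_pos
  have hin := hv.isIncomingFamily hφ
  have s1 : {w : ℂ | -Real.pi < w.im ∧ w.im < Real.pi} ⊆ outgoingDomain :=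
    fun w hw => ⟨hw.1, by linarith [hw.2]⟩
  have s2 : {w : ℂ | -Real.pi < w.im ∧ w.im < Real.pi} ⊆ incomingDomain :=
    fun w hw => ⟨by linarith [hw.1], hw.2⟩
  refine eqOn_strip_of_eq_on_line (c := 0)
    (f := fun w => radialWronskian (fun ξ => v ξ (w + Real.pi * Complex.I)) (fun ξ => v ξ w) 0)
    (g := fun w => 2 * Complex.I * Complex.exp w) (by linarith) hpi ?_ ?_ (fun w hw => ?_) ⟨h1, h2⟩
  · exact (((hin.analytic 0).mono s2).mul ((hv.analytic_deriv 0).mono s1)).sub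
      (((hin.analytic_deriv 0).mono s2).mul ((hv.analytic 0).mono s1))
  · exact fun w _ => by fun_prop
  · have hmem : w ∈ {w : ℂ | -Real.pi < w.im ∧ w.im < Real.pi} :=
      ⟨by rw [hw]; linarith, by rw [hw]; linarith⟩
    have hexp : Complex.exp w = (Real.exp w.re : ℝ) := by
      conv_lhs => rw [← Complex.re_add_im w, hw]
      simp
    have e1 := hv.solution w (s1 hmem)
    have e2 := hin.solution w (s2 hmem)
    have e3 := hv.asymptotics w hw.ge (by linarith)
    have e4 := hin.asymptotics w (by linarith) hw.le
    simp only [hexp] at e1 e2 e3 e4 ⊢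
    exact e2.radialWronskian_eq_two_mul_I (Real.exp_pos _) hφ e1 e4 e3

/-! ### Jost functions -/

theorem wronskian_comp_log {f g : ℝ → ℂ} (hf : Differentiable ℝ f) (hg : Differentiable ℝ g) :
    wronskian (fun x => f (Real.log (x + 1))) (fun x => g (Real.log (x + 1))) 0
      = radialWronskian f g 0 := by
  have hlog : HasDerivAt (fun x : ℝ => Real.log (x + 1)) 1 0 := by
    simpa using ((hasDerivAt_id (0 : ℝ)).add_const 1).log (by simp)
  have key : ∀ f : ℝ → ℂ, Differentiable ℝ f →
      deriv (fun x => f (Real.log (x + 1))) 0 = deriv f 0 := fun f hf => by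
    have h := (hf (Real.log (0 + 1))).hasDerivAt.scomp (0 : ℝ) hlog
    rw [one_smul, zero_add, Real.log_one] at h
    exact h.deriv
  simp [wronskian, radialWronskian, key f hf, key g hg]

theorem isRegularSolution_regular {w : ℂ} (h : jostPlus Z μ φ w ≠ 0) :
    IsRegularSolution Z μ (Complex.exp w) (regular Z μ (Complex.exp w)) := by
  by_cases hex : ∃ v, IsRegularSolution Z μ (Complex.exp w) v
  · rw [regular, dif_pos hex]; exact hex.choose_spec
  · refine absurd ?_ h
    simp [jostPlus, wronskian, regularX, regular, dif_neg hex]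

/-- If no outgoing family existed, the default value 0 would make the Jost function vanish; so `f₊ ≠
0` already carries existence. -/
theorem isOutgoingFamily_outgoing {w : ℂ} (h : jostPlus Z μ φ w ≠ 0) :
    IsOutgoingFamily Z μ φ (outgoing Z μ φ) := by
  by_cases hex : ∃ v, IsOutgoingFamily Z μ φ v
  · rw [outgoing, dif_pos hex]; exact hex.choose_spec
  · refine absurd ?_ h
    simp [jostPlus, wronskian, outgoingX, outgoing, dif_neg hex]

theorem incoming_eq_outgoing (hφ : IsGlobalPhase Z μ φ)
    (h : IsOutgoingFamily Z μ φ (outgoing Z μ φ)) {w : ℂ} (hw : w ∈ incomingDomain) (ξ : ℝ) :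
    incoming Z μ φ ξ w = outgoing Z μ φ ξ (w + Real.pi * Complex.I) := by
  have h' := h.isIncomingFamily hφ
  have hex : ∃ v, IsIncomingFamily Z μ φ v := ⟨_, h'⟩
  have : IsIncomingFamily Z μ φ (incoming Z μ φ) := by
    rw [incoming, dif_pos hex]; exact hex.choose_spec
  exact this.eq hφ h' hw ξ

theorem jostMinus_eq_jostPlus (hφ : IsGlobalPhase Z μ φ)
    (h : IsOutgoingFamily Z μ φ (outgoing Z μ φ)) {w : ℂ} (hw : w ∈ incomingDomain) :
    jostMinus Z μ φ w = jostPlus Z μ φ (w + Real.pi * Complex.I) := by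
  simp only [jostMinus, jostPlus, incomingX, outgoingX, regularX, exp_add_pi_mul_I, regular_neg,
    incoming_eq_outgoing hφ h hw]

end TwoCenter

open TwoCenter in
theorem lemma4p11 (Z : ℝ) (μ : ℂ) (φ : ℝ → ℂ → ℂ) (hφ : TwoCenter.IsGlobalPhase Z μ φ)
    (α β : ℝ) (hα : α ∈ Set.Ico 0 Real.pi) (hβ : β ∈ Set.Ico 0 Real.pi)
    (k : ℂ) (hk : k ≠ 0) (hβk : -β < Complex.arg k) (hkα : Complex.arg k < α)
    (hf : TwoCenter.jostPlus Z μ φ (TwoCenter.pt k) ≠ 0)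
    (hf' : TwoCenter.jostPlus Z μ φ (TwoCenter.negPtOut k) ≠ 0) :
    (∀ x x' : ℝ, 0 < x → 0 < x' →
      TwoCenter.greenFunction Z μ φ x x' (TwoCenter.pt k)
          - TwoCenter.greenFunction Z μ φ x x' (TwoCenter.negPtOut k)
        = 2 * Complex.I * k * TwoCenter.genEigenfunction Z μ φ (min x x') (TwoCenter.pt k)
            * TwoCenter.genEigenfunction Z μ φ (max x x') (TwoCenter.negPtOut k)) ∧
    TwoCenter.scatteringElement Z μ φ (TwoCenter.negPtOut k) (TwoCenter.negPtIn k)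
      = (TwoCenter.scatteringElement Z μ φ (TwoCenter.pt k) (TwoCenter.pt k))⁻¹ ∧
    (∀ x : ℝ, 0 < x →
      TwoCenter.scatteringElement Z μ φ (TwoCenter.pt k) (TwoCenter.pt k)
          * TwoCenter.genEigenfunction Z μ φ x (TwoCenter.negPtOut k)
        = TwoCenter.genEigenfunction Z μ φ x (TwoCenter.pt k)) := by
  have hpi := Real.pi_pos
  have him : (pt k).im = Complex.arg k := Complex.log_im k
  have h1 : -Real.pi < (pt k).im := by rw [him]; linarith [hβ.2]
  have h2 : (pt k).im < Real.pi := by rw [him]; linarith [hα.2]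
  have hout := isOutgoingFamily_outgoing hf
  have hneg : negPtOut k = pt k + Real.pi * Complex.I := rfl
  have hexp : Complex.exp (pt k) = k := Complex.exp_log hk
  have hexp' : Complex.exp (negPtOut k) = -k := by rw [hneg, exp_add_pi_mul_I, hexp]
  have hmem : pt k ∈ incomingDomain := ⟨by linarith, h2⟩
  have hmem' : negPtIn k ∈ incomingDomain := by
    have : (negPtIn k).im = (pt k).im - Real.pi := by simp [negPtIn, pt]
    exact ⟨by rw [this]; linarith, by rw [this]; linarith⟩
  have hJ : jostMinus Z μ φ (pt k) = jostPlus Z μ φ (negPtOut k) :=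
    jostMinus_eq_jostPlus hφ hout hmem
  have hJ' : jostMinus Z μ φ (negPtIn k) = jostPlus Z μ φ (pt k) := by
    rw [jostMinus_eq_jostPlus hφ hout hmem', negPtIn, pt, sub_add_cancel]
  refine ⟨fun x x' _ _ => ?_, ?_, fun x _ => ?_⟩
  · have hreg := isRegularSolution_regular hf
    have hsol := hout.solution (pt k) ⟨h1, by linarith⟩
    have hsol' := (hout.isIncomingFamily hφ).solution (pt k) hmem
    rw [hexp] at hreg hsol hsol'
    have hJp : jostPlus Z μ φ (pt k)
        = radialWronskian (fun ξ => outgoing Z μ φ ξ (pt k)) (regular Z μ k) 0 := by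
      rw [jostPlus, hexp]
      exact wronskian_comp_log hsol.differentiable hreg.solution.differentiable
    have hJn : jostPlus Z μ φ (negPtOut k)
        = radialWronskian (fun ξ => outgoing Z μ φ ξ (negPtOut k)) (regular Z μ k) 0 := by
      rw [jostPlus, hexp']
      simp only [regularX, regular_neg]
      exact wronskian_comp_log hsol'.differentiable hreg.solution.differentiable
    have hW := hout.radialWronskian_add_pi hφ h1 h2
    rw [hexp, ← hneg] at hW
    rw [← hneg] at hsol'
    -- Three solutions of a second-order equation satisfy a linear relation with their Wronskians as
    -- coefficients; with all Wronskians moved to the point of `max x x'` it is a polynomial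
    -- identity.
    have key : outgoingX Z μ φ (max x x') (pt k) * jostPlus Z μ φ (negPtOut k)
        - outgoingX Z μ φ (max x x') (negPtOut k) * jostPlus Z μ φ (pt k)
        = 2 * Complex.I * k * regularX Z μ (max x x') k := by
      rw [← hW, hJp, hJn, hsol.radialWronskian_eq hreg.solution 0 (Real.log (max x x' + 1)),
        hsol'.radialWronskian_eq hreg.solution 0 (Real.log (max x x' + 1)),
        hsol'.radialWronskian_eq hsol 0 (Real.log (max x x' + 1))]
      simp only [radialWronskian, outgoingX, regularX]
      ring
    have hr : ∀ y, regularX Z μ y (-k) = regularX Z μ y k := fun y => by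
      simp only [regularX, regular_neg]
    simp only [greenFunction, genEigenfunction, hexp, hexp', hr]
    field_simp
    linear_combination regularX Z μ (min x x') k * key
  · rw [scatteringElement, scatteringElement, hJ, hJ', inv_div]
  · have hr : regularX Z μ x (-k) = regularX Z μ x k := by simp only [regularX, regular_neg]
    simp only [scatteringElement, genEigenfunction, hJ, hexp, hexp', hr]
    field_simp
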